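/- Let $X\subset\mathbb{C}^n$ be a domain (a non-empty open connected set). A function $L:X\times X\to\mathbb{C}$ is *non-degenerate* if $L(x,x)>0$ for all $x\in X$, and *sesqui-holomorphic* if it is holomorphic in the first and antiholomorphic in the second variable. A non-degenerate function $M$ is a *rescaling* of a non-degenerate function $L$ if $M(x,y)=\omega(x)\overline{\omega(y)}L(x,y)$ on $X\times X$ for some function $\omega:X\to\mathbb{C}$. A *projectively invariant kernel* on $X$ is a sesqui-holomorphic, non-degenerate, positive semi-definite function $K:X\times X\to\mathbb{C}$ such that, for every automorphism $\Phi$ of $X$ (bijective holomorphic self-map), the function $(x,y)\mapsto K(\Phi(x),\Phi(y))$ is a rescaling of $K$. For $s\in\mathbb{R}$, the power $K^s$ is *well-defined* if there is a sesqui-holomorphic function $K^s$ on $X\times X$ such that $K^s(x,y)$ is one of the values of the multivalued power $K(x,y)^s$ for all $x,y\in X$ (with $0^s=0$ for $s>0$, $0^0=1$, and $0^s$ undefined for $s<0$) and such that $K^s(x,x)$ is the positive number $K(x,x)^s$ for all $x\in X$. Then: 1. If $K$ and $L$ are projectively invariant kernels on $X$, then so is their pointwise product $KL$. 2. If $M$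 is a rescaling of a projectively invariant kernel on $X$, then $M$ is positive semi-definite and $(x,y)\mapsto M(\Phi(x),\Phi(y))$ is a rescaling of $M$ for every automorphism $\Phi$ of $X$. In particular, if $M$ is in addition sesqui-holomorphic, then $M$ is a projectively invariant kernel. 3. If $K$ is a projectively invariant kernel on $X$, $s\in\mathbb{R}$, and $K^s$ is well-defined and positive semi-definite, then $K^s$ is a projectively invariant kernel. 4. If a net (in particular, a sequence) of projectively invariant kernels on $X$ converges in the compact-open topology, i.e. uniformly on compact subsets of $X\times X$, to a non-degenerate function $L$ on $X\times X$, then $L$ is a projectively invariant kernel. -/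

import Mathlib

open scoped ComplexOrder ComplexConjugate

namespace ProjKernel

/-! Functions on `X × X`, for a subset `X` of `ℂⁿ`, are represented by functions on the ambient
space; every notion below only looks at their values at points of `X`. -/

/-- `L` is non-degenerate on `X`: its diagonal values are (real and) strictly positive. -/
def IsNonDegenerate {n : ℕ} (X : Set (EuclideanSpace ℂ (Fin n)))
    (L : EuclideanSpace ℂ (Fin n) → EuclideanSpace ℂ (Fin n) → ℂ) : Prop :=
  ∀ x ∈ X, 0 < L x x

/-- `M` is a rescaling of `L` on `X`: both are non-degenerate and
`M(x, y) = ω(x) * conj (ω(y)) * L(x, y)` for some (arbitrary) function `ω`. -/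
def IsRescaling {n : ℕ} (X : Set (EuclideanSpace ℂ (Fin n)))
    (M L : EuclideanSpace ℂ (Fin n) → EuclideanSpace ℂ (Fin n) → ℂ) : Prop :=
  IsNonDegenerate X M ∧ IsNonDegenerate X L ∧
    ∃ ω : EuclideanSpace ℂ (Fin n) → ℂ,
      ∀ x ∈ X, ∀ y ∈ X, M x y = ω x * conj (ω y) * L x y

/-- `K` is positive semi-definite on `X`. -/
def IsPosSemidefKernel {n : ℕ} (X : Set (EuclideanSpace ℂ (Fin n)))
    (K : EuclideanSpace ℂ (Fin n) → EuclideanSpace ℂ (Fin n) → ℂ) : Prop :=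
  ∀ (m : ℕ) (x : Fin m → EuclideanSpace ℂ (Fin n)), (∀ i, x i ∈ X) →
    (Matrix.of fun i j => K (x i) (x j)).PosSemidef

/-- `L` is sesqui-holomorphic on `X`: holomorphic in the first variable and antiholomorphic
(the conjugate is holomorphic) in the second one. -/
def IsSesquiHolomorphic {n : ℕ} (X : Set (EuclideanSpace ℂ (Fin n)))
    (L : EuclideanSpace ℂ (Fin n) → EuclideanSpace ℂ (Fin n) → ℂ) : Prop :=
  (∀ y ∈ X, DifferentiableOn ℂ (fun x => L x y) X) ∧
    (∀ x ∈ X, DifferentiableOn ℂ (fun y => conj (L x y)) X)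

/-- `Φ` restricts to an automorphism of `X`: a bijective holomorphic self-map. -/
def IsAutomorphism {n : ℕ} (X : Set (EuclideanSpace ℂ (Fin n)))
    (Φ : EuclideanSpace ℂ (Fin n) → EuclideanSpace ℂ (Fin n)) : Prop :=
  Set.BijOn Φ X X ∧ DifferentiableOn ℂ Φ X

/-- The invariance property: `L ∘ Φ` is a rescaling of `L` for every automorphism `Φ` of `X`. -/
def IsRescaledByAut {n : ℕ} (X : Set (EuclideanSpace ℂ (Fin n)))
    (L : EuclideanSpace ℂ (Fin n) → EuclideanSpace ℂ (Fin n) → ℂ) : Prop :=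
  ∀ Φ : EuclideanSpace ℂ (Fin n) → EuclideanSpace ℂ (Fin n), IsAutomorphism X Φ →
    IsRescaling X (fun x y => L (Φ x) (Φ y)) L

/-- `K` is a projectively invariant kernel on `X`: a sesqui-holomorphic, non-degenerate,
positive semi-definite kernel such that `K ∘ Φ` is a rescaling of `K` for every automorphism. -/
structure IsProjInvKernel {n : ℕ} (X : Set (EuclideanSpace ℂ (Fin n)))
    (K : EuclideanSpace ℂ (Fin n) → EuclideanSpace ℂ (Fin n) → ℂ) : Prop where
  sesquiHolomorphic : IsSesquiHolomorphic X K
  nonDegenerate : IsNonDegenerate X K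
  posSemidef : IsPosSemidefKernel X K
  rescaledByAut : IsRescaledByAut X K

/-- `p` is one of the values of the multivalued power `z ^ s`, `s` real: `p = exp (s * w)` for some
logarithm `w` of `z` if `z ≠ 0`; and `0 ^ s = 0` for `s > 0`, `0 ^ 0 = 1`, while `0 ^ s` is
undefined for `s < 0`. -/
def IsPowerValue (s : ℝ) (z p : ℂ) : Prop :=
  (z ≠ 0 → ∃ w : ℂ, Complex.exp w = z ∧ p = Complex.exp ((s : ℂ) * w)) ∧
    (z = 0 → 0 ≤ s ∧ p = (((0 : ℝ) ^ s : ℝ) : ℂ))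

/-- The power `L ^ s` is well-defined on `X × X` and equal to `P`: `P` is a single-valued
sesqui-holomorphic branch of the multivalued function `L ^ s`, namely the one that on the diagonal
is the ordinary positive power of the positive number `L(x, x)`. -/
def IsPower {n : ℕ} (X : Set (EuclideanSpace ℂ (Fin n))) (s : ℝ)
    (L P : EuclideanSpace ℂ (Fin n) → EuclideanSpace ℂ (Fin n) → ℂ) : Prop :=
  IsSesquiHolomorphic X P ∧
    (∀ x ∈ X, ∀ y ∈ X, IsPowerValue s (L x y) (P x y)) ∧
    (∀ x ∈ X, P x x = (((L x x).re ^ s : ℝ) : ℂ))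

/-- `K i` converges to `L` along `l` in the compact-open topology of functions on `X × X`, i.e.
uniformly on every compact subset of `X × X`. -/
def CompactOpenTendsto {n : ℕ} {ι : Type*} (X : Set (EuclideanSpace ℂ (Fin n))) (l : Filter ι)
    (K : ι → EuclideanSpace ℂ (Fin n) → EuclideanSpace ℂ (Fin n) → ℂ)
    (L : EuclideanSpace ℂ (Fin n) → EuclideanSpace ℂ (Fin n) → ℂ) : Prop :=
  ∀ C : Set (EuclideanSpace ℂ (Fin n) × EuclideanSpace ℂ (Fin n)), IsCompact C → C ⊆ X ×ˢ X →
    TendstoUniformlyOn (fun i p => K i p.1 p.2) (fun p => L p.1 p.2) l C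

end ProjKernel

open Set Filter Topology Metric

/-! Products and rescalings rest on the Schur product theorem: rescaling is a Hadamard product with
a rank-one positive matrix.

Powers are the delicate case. If `L = K ∘ Φ` is rescaled from `K` by `ω`, the ratio `r = Q / P` of
their powers should be `(ω(x) conj ω(y)) ^ s`, but `ω` is arbitrary and offers no coherent branch of
`ω ^ s`. Instead one shows `r(x,y) r(z,w) = r(x,w) r(z,y)`, which says that `r` splits into a
function of `x` times a function of `y` (`IsPower.four_point`). In `x`, both sides are values of the
same power, so their quotient lies in a countable set; it is locally constant, equals 1 at `x = z`,
and the identity principle finishes. Hermitian symmetry turns the splitting into a rescaling.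

For limits, diagonal values bound the rescaling functions, so these converge pointwise along an
ultrafilter. -/

/-! ### Analytic preliminaries -/

/-- The identity principle for holomorphic functions on an open connected subset of a complex
normed space. -/
theorem DifferentiableOn.eqOn_zero_of_isPreconnected {E : Type*} [NormedAddCommGroup E]
    [NormedSpace ℂ E] {f : E → ℂ} {U : Set E} (hf : DifferentiableOn ℂ f U) (hU : IsOpen U)
    (hUc : IsPreconnected U) {z : E} (hz : z ∈ U) (hfz : ∀ᶠ x in 𝓝 z, f x = 0) :
    ∀ x ∈ U, f x = 0 := by
  have hsub : U ⊆ {x | ∀ᶠ y in 𝓝 x, f y = 0} := by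
    refine hUc.subset_of_closure_inter_subset isOpen_setOfPred_eventually_nhds ⟨z, hz, hfz⟩ ?_
    rintro x ⟨hxc, hxU⟩
    obtain ⟨r, hr, hrU⟩ := Metric.isOpen_iff.1 hU x hxU
    obtain ⟨p, hp, hpx⟩ := Metric.mem_closure_iff.1 hxc r hr
    have hpB : p ∈ ball x r := by rwa [mem_ball, dist_comm]
    filter_upwards [ball_mem_nhds x hr] with q hq
    -- Restricting to the complex line through `p` (at 0) and `q` (at 1) reduces to one variable;
    -- the part of the line inside the ball is convex.
    let ℓ : ℂ → E := fun t => p + t • (q - p)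
    have hℓ : Differentiable ℂ ℓ := by fun_prop
    have hV : IsOpen (ℓ ⁻¹' ball x r) := isOpen_ball.preimage hℓ.continuous
    have hVc : Convex ℝ (ℓ ⁻¹' ball x r) := by
      intro s hs t ht a b ha hb hab
      have : ℓ (a • s + b • t) = a • ℓ s + b • ℓ t := by
        simp only [ℓ, smul_add, add_smul, smul_assoc]
        calc p + (a • s • (q - p) + b • t • (q - p))
            = (a + b) • p + (a • s • (q - p) + b • t • (q - p)) := by rw [hab, one_smul]
          _ = _ := by rw [add_smul]; abel
      rw [mem_preimage, this]
      exact convex_ball x r hs ht ha hb hab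
    have han : AnalyticOnNhd ℂ (f ∘ ℓ) (ℓ ⁻¹' ball x r) :=
      ((hf.mono hrU).comp hℓ.differentiableOn fun _ h => h).analyticOnNhd hV
    have h0 : (0 : ℂ) ∈ ℓ ⁻¹' ball x r := by simpa [ℓ] using hpx.trans_eq' (dist_comm _ _)
    have h1 : (1 : ℂ) ∈ ℓ ⁻¹' ball x r := by simpa [ℓ] using hq
    have hev : (f ∘ ℓ) =ᶠ[𝓝 0] 0 := by
      have : Tendsto ℓ (𝓝 0) (𝓝 p) := by
        simpa [ℓ] using hℓ.continuous.tendsto 0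
      exact this.eventually hp
    simpa [ℓ] using
      han.eqOn_zero_of_preconnected_of_eventuallyEq_zero hVc.isPreconnected h0 hev h1
  exact fun x hx => (hsub hx).self_of_nhds

/-- Nonzero holomorphic functions on a domain have a nonzero product. -/
theorem DifferentiableOn.exists_mul_ne_zero {E : Type*} [NormedAddCommGroup E]
    [NormedSpace ℂ E] {f g : E → ℂ} {U : Set E} (hf : DifferentiableOn ℂ f U)
    (hg : DifferentiableOn ℂ g U) (hU : IsOpen U) (hUc : IsPreconnected U)
    (hf0 : ∃ x ∈ U, f x ≠ 0) (hg0 : ∃ x ∈ U, g x ≠ 0) : ∃ x ∈ U, f x * g x ≠ 0 := by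
  by_contra! h
  obtain ⟨a, ha, hfa⟩ := hf0
  obtain ⟨b, hb, hgb⟩ := hg0
  refine hgb (hg.eqOn_zero_of_isPreconnected hU hUc ha ?_ b hb)
  have hfc : ContinuousAt f a := (hf.continuousOn.continuousAt (hU.mem_nhds ha))
  filter_upwards [hfc.eventually_ne hfa, hU.mem_nhds ha] with x hx hxU
  exact (mul_eq_zero.1 (h x hxU)).resolve_left hx

/-- A locally uniform limit of holomorphic functions on an open subset of a finite-dimensional
complex normed space is holomorphic. -/
theorem differentiableOn_of_tendstoUniformlyOn_isCompact {E ι : Type*} [NormedAddCommGroup E]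
    [NormedSpace ℂ E] [ProperSpace E] {U : Set E} (hU : IsOpen U) {l : Filter ι} [l.NeBot]
    {F : ι → E → ℂ} {f : E → ℂ} (hF : ∀ i, DifferentiableOn ℂ (F i) U)
    (hlim : ∀ C ⊆ U, IsCompact C → TendstoUniformlyOn F f l C) : DifferentiableOn ℂ f U := by
  intro x hx
  obtain ⟨R, hR, hRU⟩ := Metric.nhds_basis_closedBall.mem_iff.1 (hU.mem_nhds hx)
  obtain ⟨r, hr, rfl⟩ : ∃ r, 0 < r ∧ 2 * r = R := ⟨R / 2, by positivity, by ring⟩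
  have hunif := hlim _ hRU (isCompact_closedBall x (2 * r))
  have hsub : ∀ y ∈ ball x r, ball y r ⊆ closedBall x (2 * r) := fun y hy z hz => by
    rw [mem_ball] at hy hz
    rw [mem_closedBall]
    linarith [dist_triangle z y x]
  have hdiff : ∀ i, ∀ y ∈ ball x r, DifferentiableAt ℂ (F i) y := fun i y hy =>
    (hF i).differentiableAt (hU.mem_nhds (hRU (hsub y hy (mem_ball_self hr))))
  have hcauchy : UniformCauchySeqOn (fun i => fderiv ℂ (F i)) l (ball x r) := by
    intro u hu
    obtain ⟨ε, hε, hεu⟩ := Metric.mem_uniformity_dist.1 hu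
    -- Differences below `ε * r / 4` map a ball of radius `r` into one of radius `ε * r / 2`, so the
    -- Cauchy estimate bounds the derivative by `ε / 2`.
    filter_upwards [hunif.uniformCauchySeqOn _
      (Metric.dist_mem_uniformity (show 0 < ε * r / 4 by positivity))] with m hm y hy
    refine hεu ?_
    rw [dist_eq_norm_sub, ← fderiv_sub (hdiff _ y hy) (hdiff _ y hy)]
    have hmaps : MapsTo (F m.1 - F m.2) (ball y r)
        (closedBall ((F m.1 - F m.2) y) (ε * r / 4 + ε * r / 4)) := by
      intro z hz
      have h1 := hm z (hsub y hy hz)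
      have h2 := hm y (hsub y hy (mem_ball_self hr))
      rw [dist_eq_norm_sub] at h1 h2
      rw [mem_closedBall, dist_eq_norm_sub]
      exact (norm_sub_le _ _).trans (add_le_add h1.le h2.le)
    have hd : DifferentiableOn ℂ (F m.1 - F m.2) (ball y r) :=
      ((hF _).sub (hF _)).mono ((hsub y hy).trans hRU)
    refine (Complex.norm_fderiv_le_div_of_mapsTo_ball hd hmaps hr).trans_lt ?_
    rw [div_lt_iff₀ hr]
    nlinarith [mul_pos hε hr]
  choose! g hg using fun y (hy : y ∈ ball x r) => cauchy_map_iff_exists_tendsto.1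
    (hcauchy.cauchy_map hy)
  have hder := hasFDerivAt_of_tendstoUniformlyOn isOpen_ball
    (hcauchy.tendstoUniformlyOn_of_tendsto hg) (fun i y hy => (hdiff i y hy).hasFDerivAt)
    (fun y hy => hunif.tendsto_at (hsub y hy (mem_ball_self hr))) (mem_ball_self hr)
  exact hder.differentiableAt.differentiableWithinAt

/-- A continuous function with countably many values near a point is locally constant there. -/
theorem ContinuousOn.eventually_eq_of_countable_image {E : Type*} [NormedAddCommGroup E]
    [NormedSpace ℝ E] {h : E → ℂ} {U : Set E} (hU : IsOpen U) (hh : ContinuousOn h U)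
    {S : Set ℂ} (hS : S.Countable) (hmaps : MapsTo h U S) {z : E} (hz : z ∈ U) :
    ∀ᶠ x in 𝓝 z, h x = h z := by
  obtain ⟨r, hr, hrU⟩ := Metric.isOpen_iff.1 hU z hz
  have hpre : IsPreconnected (h '' ball z r) :=
    (convex_ball z r).isPreconnected.image h (hh.mono hrU)
  have hsub := hS.isTotallyDisconnected _ ((hmaps.mono_left hrU).image_subset) hpre
  filter_upwards [ball_mem_nhds z hr] with x hx
  exact hsub (mem_image_of_mem h hx) (mem_image_of_mem h (mem_ball_self hr))

namespace ProjKernel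

variable {n : ℕ} {X : Set (EuclideanSpace ℂ (Fin n))}
  {K L M P : EuclideanSpace ℂ (Fin n) → EuclideanSpace ℂ (Fin n) → ℂ}

/-! ### Positivity, products and rescalings -/

theorem IsPosSemidefKernel.conj_eq (hK : IsPosSemidefKernel X K)
    {x y : EuclideanSpace ℂ (Fin n)} (hx : x ∈ X) (hy : y ∈ X) : conj (K x y) = K y x := by
  have h := (hK 2 ![x, y] (by simp [Fin.forall_fin_two, hx, hy])).isHermitian.apply 1 0
  simpa using h

theorem IsPosSemidefKernel.mul (hK : IsPosSemidefKernel X K) (hL : IsPosSemidefKernel X L) :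
    IsPosSemidefKernel X (fun x y => K x y * L x y) :=
  fun m x hx => (hK m x hx).hadamard (hL m x hx)

theorem IsPosSemidefKernel.rescale (hK : IsPosSemidefKernel X K)
    {ω : EuclideanSpace ℂ (Fin n) → ℂ}
    (hM : ∀ x ∈ X, ∀ y ∈ X, M x y = ω x * conj (ω y) * K x y) : IsPosSemidefKernel X M := by
  intro m x hx
  have h : (Matrix.of fun i j => M (x i) (x j)) =
      (Matrix.vecMulVec (fun i => ω (x i)) (star fun i => ω (x i))).hadamard
        (Matrix.of fun i j => K (x i) (x j)) := by
    ext i j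
    simpa [Matrix.vecMulVec_apply] using hM _ (hx i) _ (hx j)
  rw [h]
  exact (Matrix.posSemidef_vecMulVec_self_star (fun i => ω (x i))).hadamard (hK m x hx)

theorem IsPosSemidefKernel.of_tendsto {ι : Type*} {l : Filter ι} [l.NeBot]
    {F : ι → EuclideanSpace ℂ (Fin n) → EuclideanSpace ℂ (Fin n) → ℂ}
    (hF : ∀ i, IsPosSemidefKernel X (F i))
    (hlim : ∀ x ∈ X, ∀ y ∈ X, Tendsto (fun i => F i x y) l (𝓝 (L x y))) :
    IsPosSemidefKernel X L := by
  intro m x hx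
  refine Matrix.PosSemidef.of_dotProduct_mulVec_nonneg ?_ fun v => ?_
  · ext i j
    have h1 := (Complex.continuous_conj.tendsto _).comp (hlim _ (hx j) _ (hx i))
    refine tendsto_nhds_unique (h1.congr fun k => ?_) (hlim _ (hx i) _ (hx j))
    exact (hF k).conj_eq (hx j) (hx i)
  · refine ge_of_tendsto' (b := (0 : ℂ)) (f := fun k => star v ⬝ᵥ
      (Matrix.of (fun i j => F k (x i) (x j))).mulVec v) (x := l) ?_
      fun k => ((hF k) m x hx).dotProduct_mulVec_nonneg v
    simp only [dotProduct, Matrix.mulVec, Matrix.of_apply]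
    exact tendsto_finsetSum _ fun i _ => tendsto_const_nhds.mul <|
      tendsto_finsetSum _ fun j _ => (hlim _ (hx i) _ (hx j)).mul tendsto_const_nhds

theorem IsSesquiHolomorphic.mul (hK : IsSesquiHolomorphic X K) (hL : IsSesquiHolomorphic X L) :
    IsSesquiHolomorphic X (fun x y => K x y * L x y) :=
  ⟨fun y hy => (hK.1 y hy).mul (hL.1 y hy), fun x hx =>
    ((hK.2 x hx).mul (hL.2 x hx)).congr fun _ _ => map_mul _ _ _⟩

theorem IsNonDegenerate.comp (hK : IsNonDegenerate X K)
    {Φ : EuclideanSpace ℂ (Fin n) → EuclideanSpace ℂ (Fin n)} (hΦ : MapsTo Φ X X) :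
    IsNonDegenerate X (fun x y => K (Φ x) (Φ y)) := fun _ hx => hK _ (hΦ hx)

theorem IsNonDegenerate.ne_zero_of_rescaling (hM : IsNonDegenerate X M)
    {ω : EuclideanSpace ℂ (Fin n) → ℂ}
    (h : ∀ x ∈ X, ∀ y ∈ X, M x y = ω x * conj (ω y) * K x y) : ∀ x ∈ X, ω x ≠ 0 := by
  intro x hx h0
  have := (hM x hx).ne'
  simp [h x hx x hx, h0] at this

theorem IsProjInvKernel.mul (hK : IsProjInvKernel X K) (hL : IsProjInvKernel X L) :
    IsProjInvKernel X (fun x y => K x y * L x y) where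
  sesquiHolomorphic := hK.sesquiHolomorphic.mul hL.sesquiHolomorphic
  nonDegenerate x hx := mul_pos (hK.nonDegenerate x hx) (hL.nonDegenerate x hx)
  posSemidef := hK.posSemidef.mul hL.posSemidef
  rescaledByAut Φ hΦ := by
    obtain ⟨h1, h2, ω, hω⟩ := hK.rescaledByAut Φ hΦ
    obtain ⟨h1', h2', η, hη⟩ := hL.rescaledByAut Φ hΦ
    refine ⟨fun x hx => mul_pos (h1 x hx) (h1' x hx), fun x hx => mul_pos (h2 x hx) (h2' x hx),
      fun x => ω x * η x, fun x hx y hy => ?_⟩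
    simp only [hω x hx y hy, hη x hx y hy, map_mul]
    ring

theorem IsRescaledByAut.of_rescaling (hK : IsRescaledByAut X K) (hM : IsRescaling X M K) :
    IsRescaledByAut X M := by
  obtain ⟨hM0, -, ω, hω⟩ := hM
  have hne := hM0.ne_zero_of_rescaling hω
  intro Φ hΦ
  obtain ⟨-, -, η, hη⟩ := hK Φ hΦ
  -- Rescale back from `M` to `K`, apply the factor `η` of `K`, then rescale at the image points.
  refine ⟨hM0.comp hΦ.1.mapsTo, hM0, fun x => ω (Φ x) * η x / ω x, fun x hx y hy => ?_⟩
  have hx0 := hne x hx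
  have hy0 : conj (ω y) ≠ 0 := by simpa using hne y hy
  simp only [hω _ (hΦ.1.mapsTo hx) _ (hΦ.1.mapsTo hy), hη x hx y hy, hω x hx y hy, map_mul,
    map_div₀]
  field_simp

/-! ### Real powers -/

theorem IsPowerValue.ne_zero {s : ℝ} {z p : ℂ} (h : IsPowerValue s z p) (hz : z ≠ 0) : p ≠ 0 := by
  obtain ⟨w, -, rfl⟩ := h.1 hz
  exact Complex.exp_ne_zero _

theorem IsPowerValue.eq_zero_iff {s : ℝ} (hs : s ≠ 0) {z p : ℂ} (h : IsPowerValue s z p) :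
    p = 0 ↔ z = 0 := by
  refine ⟨fun hp => by_contra fun hz => h.ne_zero hz hp, fun hz => ?_⟩
  rw [(h.2 hz).2, Real.zero_rpow hs, Complex.ofReal_zero]

theorem IsPowerValue.eq_one {z p : ℂ} (h : IsPowerValue 0 z p) : p = 1 := by
  by_cases hz : z = 0
  · simpa using (h.2 hz).2
  · obtain ⟨w, -, hw⟩ := h.1 hz
    simpa using hw

theorem IsPowerValue.mul {s : ℝ} {z p z' p' : ℂ} (hz : z ≠ 0) (hz' : z' ≠ 0)
    (h : IsPowerValue s z p) (h' : IsPowerValue s z' p') : IsPowerValue s (z * z') (p * p') := by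
  obtain ⟨w, rfl, rfl⟩ := h.1 hz
  obtain ⟨w', rfl, rfl⟩ := h'.1 hz'
  refine ⟨fun _ => ⟨w + w', Complex.exp_add _ _, ?_⟩, fun h0 => absurd h0 (mul_ne_zero hz hz')⟩
  rw [mul_add, Complex.exp_add]

/-- Two values of the same power of a nonzero number differ by a power of `exp (2 π i s)`. -/
theorem IsPowerValue.div_mem_range {s : ℝ} {z p q : ℂ} (hz : z ≠ 0) (hp : IsPowerValue s z p)
    (hq : IsPowerValue s z q) :
    p / q ∈ range fun k : ℤ => Complex.exp (s * (k * (2 * Real.pi * Complex.I))) := by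
  obtain ⟨w, hw, rfl⟩ := hp.1 hz
  obtain ⟨w', hw', rfl⟩ := hq.1 hz
  obtain ⟨k, hk⟩ := Complex.exp_eq_exp_iff_exists_int.1 (hw.trans hw'.symm)
  refine ⟨k, ?_⟩
  simp only
  rw [← Complex.exp_sub, hk]
  ring_nf

theorem IsPower.nonDegenerate {s : ℝ} (hP : IsPower X s K P) (hK : IsNonDegenerate X K) :
    IsNonDegenerate X P := fun x hx => by
  rw [hP.2.2 x hx]
  exact_mod_cast Real.rpow_pos_of_pos (Complex.pos_iff.1 (hK x hx)).1 s

/-- The ratio of the powers of two kernels that are rescalings of each other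
satisfies the multiplicative four-point identity (written without denominators). -/
theorem IsPower.four_point {s : ℝ} (hXo : IsOpen X) (hXc : IsPreconnected X)
    {Q : EuclideanSpace ℂ (Fin n) → EuclideanSpace ℂ (Fin n) → ℂ}
    (hs : s ≠ 0) (hP : IsPower X s K P) (hQ : IsPower X s L Q)
    {ω : EuclideanSpace ℂ (Fin n) → ℂ} (hω0 : ∀ x ∈ X, ω x ≠ 0)
    (hω : ∀ x ∈ X, ∀ y ∈ X, L x y = ω x * conj (ω y) * K x y)
    {x y z w : EuclideanSpace ℂ (Fin n)} (hx : x ∈ X) (hy : y ∈ X) (hz : z ∈ X) (hw : w ∈ X) :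
    Q x y * P x w * (P z y * Q z w) = P x y * Q x w * (Q z y * P z w) := by
  have hL0 : ∀ x ∈ X, ∀ y ∈ X, K x y ≠ 0 → L x y ≠ 0 := fun x hx y hy h => by
    rw [hω x hx y hy]
    exact mul_ne_zero (mul_ne_zero (hω0 x hx) (by simpa using hω0 y hy)) h
  have hzero : ∀ x ∈ X, ∀ y ∈ X, K x y = 0 → P x y = 0 ∧ Q x y = 0 := fun x hx y hy h =>
    ⟨((hP.2.1 x hx y hy).eq_zero_iff hs).2 h,
      ((hQ.2.1 x hx y hy).eq_zero_iff hs).2 (by rw [hω x hx y hy, h, mul_zero])⟩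
  by_cases hzy : K z y = 0
  · simp [hzero z hz y hy hzy]
  by_cases hzw : K z w = 0
  · simp [hzero z hz w hw hzw]
  have hPzy := (hP.2.1 z hz y hy).ne_zero hzy
  have hPzw := (hP.2.1 z hz w hw).ne_zero hzw
  have hQzy := (hQ.2.1 z hz y hy).ne_zero (hL0 z hz y hy hzy)
  have hQzw := (hQ.2.1 z hz w hw).ne_zero (hL0 z hz w hw hzw)
  -- The two sides as functions of the first variable; they agree at `z`, where neither vanishes.
  let f : EuclideanSpace ℂ (Fin n) → ℂ := fun x => Q x y * P x w * (P z y * Q z w)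
  let g : EuclideanSpace ℂ (Fin n) → ℂ := fun x => P x y * Q x w * (Q z y * P z w)
  have hf : DifferentiableOn ℂ f X := ((hQ.1.1 y hy).mul (hP.1.1 w hw)).mul_const _
  have hg : DifferentiableOn ℂ g X := ((hP.1.1 y hy).mul (hQ.1.1 w hw)).mul_const _
  have hfg : f z = g z := by simp only [f, g]; ring
  have hgz : g z ≠ 0 := mul_ne_zero (mul_ne_zero hPzy hQzw) (mul_ne_zero hQzy hPzw)
  have hU : IsOpen (X ∩ g ⁻¹' {0}ᶜ) := hg.continuousOn.isOpen_inter_preimage hXo isOpen_compl_singleton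
  have hmaps : MapsTo (fun x => f x / g x) (X ∩ g ⁻¹' {0}ᶜ)
      (range fun k : ℤ => Complex.exp (s * (k * (2 * Real.pi * Complex.I)))) := by
    rintro x ⟨hx, hgx⟩
    have hgx' : P x y ≠ 0 ∧ Q x w ≠ 0 := by
      constructor <;> intro h <;> simp [g, h] at hgx
    have hxy : K x y ≠ 0 := fun h => hgx'.1 (hzero x hx y hy h).1
    have hxw : K x w ≠ 0 := fun h => hgx'.2 (hzero x hx w hw h).2
    have hA : ∀ {a b c d : ℂ}, a ≠ 0 → b ≠ 0 → c ≠ 0 → d ≠ 0 → ∀ {p q r t},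
        IsPowerValue s a p → IsPowerValue s b q → IsPowerValue s c r → IsPowerValue s d t →
        IsPowerValue s (a * b * (c * d)) (p * q * (r * t)) := fun ha hb hc hd _ _ _ _ hp hq hr ht =>
      (hp.mul ha hb hq).mul (mul_ne_zero ha hb) (mul_ne_zero hc hd) (hr.mul hc hd ht)
    have hFv := hA (hL0 x hx y hy hxy) hxw hzy (hL0 z hz w hw hzw) (hQ.2.1 x hx y hy)
      (hP.2.1 x hx w hw) (hP.2.1 z hz y hy) (hQ.2.1 z hz w hw)
    have hGv := hA hxy (hL0 x hx w hw hxw) (hL0 z hz y hy hzy) hzw (hP.2.1 x hx y hy)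
      (hQ.2.1 x hx w hw) (hQ.2.1 z hz y hy) (hP.2.1 z hz w hw)
    -- All factors of `ω` cancel, so `f` and `g` are values of the same power of one number.
    have hKL : L x y * K x w * (K z y * L z w) = K x y * L x w * (L z y * K z w) := by
      simp only [hω x hx y hy, hω x hx w hw, hω z hz y hy, hω z hz w hw]
      ring
    rw [hKL] at hFv
    exact hFv.div_mem_range (mul_ne_zero (mul_ne_zero hxy (hL0 x hx w hw hxw))
      (mul_ne_zero (hL0 z hz y hy hzy) hzw)) hGv
  have hev := ContinuousOn.eventually_eq_of_countable_image hU
    ((hf.continuousOn.mono inter_subset_left).div (hg.continuousOn.mono inter_subset_left)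
      fun x hx => hx.2) (countable_range _) hmaps ⟨hz, hgz⟩
  have hzero := (hf.sub hg).eqOn_zero_of_isPreconnected hXo hXc hz (by
    filter_upwards [hev, hU.mem_nhds ⟨hz, hgz⟩] with x hx hxU
    rw [Pi.div_apply, Pi.div_apply, hfg, div_self hgz, div_eq_one_iff_eq hxU.2] at hx
    simp [hx]) x hx
  exact sub_eq_zero.1 hzero

/-- With `r = Q / P`, the new factor is `c * r(x,v) / r(o,v)` for a base point `o` and `c ^ 2 =
r(o,o)`. Since `P` may have zeros, `v` depends on `x`; the four-point identity makes the quotient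
independent of this choice. -/
theorem IsPower.isRescaling {s : ℝ} (hXo : IsOpen X) (hXc : IsConnected X)
    {Q : EuclideanSpace ℂ (Fin n) → EuclideanSpace ℂ (Fin n) → ℂ}
    (hP : IsPower X s K P) (hQ : IsPower X s L Q) (hPs : IsPosSemidefKernel X P)
    (hQs : IsPosSemidefKernel X Q) (hLK : IsRescaling X L K) : IsRescaling X Q P := by
  obtain ⟨hL0, hK0, ω, hω⟩ := hLK
  have hP0 := hP.nonDegenerate hK0
  have hQ0 := hQ.nonDegenerate hL0
  refine ⟨hQ0, hP0, ?_⟩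
  -- As `0 ^ 0 = 1`, zeros of `K` are not zeros of `P` here; both powers are constantly 1.
  rcases eq_or_ne s 0 with rfl | hs
  · exact ⟨fun _ => 1, fun x hx y hy => by
      simp [(hP.2.1 x hx y hy).eq_one, (hQ.2.1 x hx y hy).eq_one]⟩
  have hω0 := hL0.ne_zero_of_rescaling hω
  have hfour : ∀ x ∈ X, ∀ y ∈ X, ∀ z ∈ X, ∀ w ∈ X, _ := fun x hx y hy z hz w hw =>
    IsPower.four_point hXo hXc.isPreconnected hs hP hQ hω0 hω hx hy hz hw
  have hiff : ∀ x ∈ X, ∀ y ∈ X, (Q x y = 0 ↔ P x y = 0) := fun x hx y hy => by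
    rw [(hP.2.1 x hx y hy).eq_zero_iff hs, (hQ.2.1 x hx y hy).eq_zero_iff hs, hω x hx y hy]
    simp [hω0 x hx, hω0 y hy]
  obtain ⟨o, ho⟩ := hXc.nonempty
  have hmul : ∀ x ∈ X, ∃ w ∈ X, P w x * P w o ≠ 0 := fun x hx =>
    (hP.1.1 x hx).exists_mul_ne_zero (hP.1.1 o ho) hXo hXc.isPreconnected
      ⟨x, hx, (hP0 x hx).ne'⟩ ⟨o, ho, (hP0 o ho).ne'⟩
  choose! v hvX hv using hmul
  let c : ℝ := Real.sqrt ((Q o o).re / (P o o).re)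
  have hc : (c : ℂ) * c = Q o o / P o o := by
    have h1 := Complex.pos_iff.1 (hP0 o ho)
    have h2 := Complex.pos_iff.1 (hQ0 o ho)
    rw [← Complex.ofReal_mul, Real.mul_self_sqrt (div_nonneg h2.1.le h1.1.le), Complex.ofReal_div]
    congr 1
    · exact Complex.ext rfl h2.2
    · exact Complex.ext rfl h1.2
  refine ⟨fun x => c * (Q x (v x) * P o (v x) / (P x (v x) * Q o (v x))), fun x hx y hy => ?_⟩
  by_cases hxy : P x y = 0
  · rw [(hiff x hx y hy).2 hxy, hxy, mul_zero]
  have hx' := hvX x hx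
  have hy' := hvX y hy
  have hQn : ∀ a ∈ X, ∀ b ∈ X, P a b ≠ 0 → Q a b ≠ 0 := fun a ha b hb h =>
    mt (hiff a ha b hb).1 h
  have hPn : ∀ a ∈ X, ∀ b ∈ X, P a b ≠ 0 → P b a ≠ 0 := fun a ha b hb h => by
    rwa [← hPs.conj_eq ha hb, Ne, map_eq_zero]
  obtain ⟨hvx, hvo⟩ := mul_ne_zero_iff.1 (hv x hx)
  obtain ⟨hvy, hvo'⟩ := mul_ne_zero_iff.1 (hv y hy)
  -- An auxiliary point that pairs nontrivially with `y`, `o` and `v x` at once links the choices `v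
  -- x` and `v y`.
  obtain ⟨u, hu, hu0⟩ := ((hP.1.1 y hy).mul (hP.1.1 o ho)).exists_mul_ne_zero
    (hP.1.1 (v x) hx') hXo hXc.isPreconnected
    ((hP.1.1 y hy).exists_mul_ne_zero (hP.1.1 o ho) hXo hXc.isPreconnected
      ⟨y, hy, (hP0 y hy).ne'⟩ ⟨o, ho, (hP0 o ho).ne'⟩) ⟨v x, hx', (hP0 _ hx').ne'⟩
  obtain ⟨huyo, huv⟩ := mul_ne_zero_iff.1 hu0
  obtain ⟨huy, huo⟩ := mul_ne_zero_iff.1 huyo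
  simp only [map_mul, map_div₀, Complex.conj_ofReal, hPs.conj_eq ho hy', hPs.conj_eq hy hy',
    hQs.conj_eq ho hy', hQs.conj_eq hy hy']
  have hind : Q (v y) y * P (v y) o / (P (v y) y * Q (v y) o) = Q u y * P u o / (P u y * Q u o) := by
    rw [div_eq_div_iff (mul_ne_zero hvy (hQn _ hy' _ ho hvo'))
      (mul_ne_zero huy (hQn _ hu _ ho huo))]
    linear_combination hfour _ hy' _ hy _ hu _ ho
  have h1 := hfour x hx y hy u hu (v x) hx'
  have h2 := hfour o ho o ho u hu (v x) hx'
  have hPoo := (hP0 o ho).ne'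
  have hPxv := hPn _ hx' _ hx hvx
  have hQov := hQn _ ho _ hx' (hPn _ hx' _ ho hvo)
  have hQuo := hQn _ hu _ ho huo
  have hQuv := hQn _ hu _ hx' huv
  calc Q x y = Q o o / P o o * (Q x (v x) * P o (v x) / (P x (v x) * Q o (v x))) *
        (Q u y * P u o / (P u y * Q u o)) * P x y := by
        rw [div_mul_div_comm, div_mul_div_comm, div_mul_eq_mul_div, eq_div_iff (by simp [*])]
        apply mul_right_cancel₀ hQuv
        linear_combination (P o o * Q o (v x) * Q u o) * h1 - (Q x (v x) * Q u y * P x y) * h2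
    _ = _ := by rw [← hc, hind]; ring

theorem IsPower.comp_automorphism {s : ℝ} (hP : IsPower X s K P)
    {Φ : EuclideanSpace ℂ (Fin n) → EuclideanSpace ℂ (Fin n)} (hΦ : IsAutomorphism X Φ) :
    IsPower X s (fun x y => K (Φ x) (Φ y)) (fun x y => P (Φ x) (Φ y)) :=
  ⟨⟨fun y hy => (hP.1.1 (Φ y) (hΦ.1.mapsTo hy)).comp hΦ.2 hΦ.1.mapsTo,
    fun x hx => (hP.1.2 (Φ x) (hΦ.1.mapsTo hx)).comp hΦ.2 hΦ.1.mapsTo⟩,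
    fun _ hx _ hy => hP.2.1 _ (hΦ.1.mapsTo hx) _ (hΦ.1.mapsTo hy),
    fun _ hx => hP.2.2 _ (hΦ.1.mapsTo hx)⟩

theorem IsProjInvKernel.power {s : ℝ} (hXo : IsOpen X) (hXc : IsConnected X)
    (hK : IsProjInvKernel X K) (hP : IsPower X s K P) (hPs : IsPosSemidefKernel X P) :
    IsProjInvKernel X P where
  sesquiHolomorphic := hP.1
  nonDegenerate := hP.nonDegenerate hK.nonDegenerate
  posSemidef := hPs
  rescaledByAut Φ hΦ := hP.isRescaling hXo hXc (hP.comp_automorphism hΦ) hPs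
    (fun m x hx => hPs m (fun i => Φ (x i)) fun i => hΦ.1.mapsTo (hx i)) (hK.rescaledByAut Φ hΦ)

/-! ### Limits in the compact-open topology -/

section Limits

variable {ι : Type*} {l : Filter ι}
  {F : ι → EuclideanSpace ℂ (Fin n) → EuclideanSpace ℂ (Fin n) → ℂ}

theorem CompactOpenTendsto.tendsto (h : CompactOpenTendsto X l F L)
    {x y : EuclideanSpace ℂ (Fin n)} (hx : x ∈ X) (hy : y ∈ X) :
    Tendsto (fun i => F i x y) l (𝓝 (L x y)) :=
  (h {(x, y)} isCompact_singleton (by simp [hx, hy])).tendsto_at (mem_singleton (x, y))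

variable [l.NeBot]

theorem CompactOpenTendsto.differentiableOn_left (hXo : IsOpen X)
    (hF : ∀ i, IsSesquiHolomorphic X (F i)) (h : CompactOpenTendsto X l F L)
    {y : EuclideanSpace ℂ (Fin n)} (hy : y ∈ X) : DifferentiableOn ℂ (fun x => L x y) X := by
  refine differentiableOn_of_tendstoUniformlyOn_isCompact (l := l) hXo (fun i => (hF i).1 y hy)
    fun C hCX hC => ?_
  refine ((h (C ×ˢ {y}) (hC.prod isCompact_singleton)
    (prod_mono hCX (singleton_subset_iff.2 hy))).comp fun x => (x, y)).mono fun x hx => ?_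
  simpa using hx

/-- Pointwise limits of rescalings are rescalings: along an ultrafilter, the rescaling functions
converge pointwise because the values on the diagonal bound them. -/
theorem IsRescaling.of_tendsto
    {G : ι → EuclideanSpace ℂ (Fin n) → EuclideanSpace ℂ (Fin n) → ℂ}
    (h : ∀ i, IsRescaling X (G i) (F i))
    (hG : ∀ x ∈ X, ∀ y ∈ X, Tendsto (fun i => G i x y) l (𝓝 (M x y)))
    (hF : ∀ x ∈ X, ∀ y ∈ X, Tendsto (fun i => F i x y) l (𝓝 (L x y)))
    (hM : IsNonDegenerate X M) (hL : IsNonDegenerate X L) : IsRescaling X M L := by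
  refine ⟨hM, hL, ?_⟩
  choose _ hF0 ω hω using h
  have hlim : ∀ x ∈ X, ∃ a, Tendsto (fun i => ω i x) (Ultrafilter.of l) (𝓝 a) := by
    intro x hx
    -- The diagonal controls only the modulus of `ω i x`; its phase need not converge, hence the
    -- ultrafilter.
    have hratio : Tendsto (fun i => ‖ω i x‖ ^ 2) l (𝓝 ‖M x x / L x x‖) := by
      refine (((hG x hx x hx).div (hF x hx x hx) (hL x hx).ne').norm).congr fun i => ?_
      rw [Pi.div_apply, hω i x hx x hx, mul_div_cancel_right₀ _ (hF0 i x hx).ne', norm_mul,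
        RCLike.norm_conj, sq]
    have hbd : ∀ᶠ i in l, ω i x ∈ closedBall (0 : ℂ) (‖M x x / L x x‖ + 1) := by
      filter_upwards [hratio.eventually_lt_const (lt_add_one _)] with i hi
      rw [mem_closedBall_zero_iff]
      nlinarith [norm_nonneg (ω i x), norm_nonneg (M x x / L x x)]
    obtain ⟨a, -, ha⟩ := (isCompact_closedBall (0 : ℂ) _).ultrafilter_le_nhds
      ((Ultrafilter.of l).map fun i => ω i x)
      (le_principal_iff.2 (Ultrafilter.of_le l hbd))
    exact ⟨a, ha⟩
  choose! η hη using hlim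
  refine ⟨η, fun x hx y hy => tendsto_nhds_unique ((hG x hx y hy).mono_left (Ultrafilter.of_le l)) ?_⟩
  refine (((hη x hx).mul ((Complex.continuous_conj.tendsto _).comp (hη y hy))).mul
    ((hF x hx y hy).mono_left (Ultrafilter.of_le l))).congr fun i => ?_
  exact (hω i x hx y hy).symm

theorem IsProjInvKernel.of_compactOpenTendsto (hXo : IsOpen X)
    (hF : ∀ i, IsProjInvKernel X (F i)) (h : CompactOpenTendsto X l F L)
    (hL : IsNonDegenerate X L) : IsProjInvKernel X L := by
  have hlim : ∀ x ∈ X, ∀ y ∈ X, Tendsto (fun i => F i x y) l (𝓝 (L x y)) :=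
    fun x hx y hy => h.tendsto hx hy
  have hpos : IsPosSemidefKernel X L := .of_tendsto (fun i => (hF i).posSemidef) hlim
  have hleft : ∀ y ∈ X, DifferentiableOn ℂ (fun x => L x y) X := fun y hy =>
    h.differentiableOn_left hXo (fun i => (hF i).sesquiHolomorphic) hy
  -- Antiholomorphy in the second variable follows from Hermitian symmetry.
  refine ⟨⟨hleft, fun x hx => (hleft x hx).congr fun y hy => hpos.conj_eq hx hy⟩, hL, hpos,
    fun Φ hΦ => ?_⟩
  exact .of_tendsto (fun i => (hF i).rescaledByAut Φ hΦ)
    (fun x hx y hy => hlim _ (hΦ.1.mapsTo hx) _ (hΦ.1.mapsTo hy)) hlim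
    (hL.comp hΦ.1.mapsTo) hL

end Limits

end ProjKernel

theorem mainTheorem7 {n : ℕ} (X : Set (EuclideanSpace ℂ (Fin n)))
    (hXo : IsOpen X) (hXc : IsConnected X) :
    -- products
    (∀ K L : EuclideanSpace ℂ (Fin n) → EuclideanSpace ℂ (Fin n) → ℂ,
      ProjKernel.IsProjInvKernel X K → ProjKernel.IsProjInvKernel X L →
      ProjKernel.IsProjInvKernel X (fun x y => K x y * L x y)) ∧
    -- rescalings
    (∀ K M : EuclideanSpace ℂ (Fin n) → EuclideanSpace ℂ (Fin n) → ℂ,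
      ProjKernel.IsProjInvKernel X K → ProjKernel.IsRescaling X M K →
      (ProjKernel.IsPosSemidefKernel X M ∧ ProjKernel.IsRescaledByAut X M) ∧
      (ProjKernel.IsSesquiHolomorphic X M → ProjKernel.IsProjInvKernel X M)) ∧
    -- well-defined positive semi-definite real powers
    (∀ (K P : EuclideanSpace ℂ (Fin n) → EuclideanSpace ℂ (Fin n) → ℂ) (s : ℝ),
      ProjKernel.IsProjInvKernel X K → ProjKernel.IsPower X s K P →
      ProjKernel.IsPosSemidefKernel X P →
      ProjKernel.IsProjInvKernel X P) ∧
    -- non-degenerate limits of nets in the compact-open topology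
    (∀ (ι : Type*) (l : Filter ι) [l.NeBot]
      (K : ι → EuclideanSpace ℂ (Fin n) → EuclideanSpace ℂ (Fin n) → ℂ)
      (L : EuclideanSpace ℂ (Fin n) → EuclideanSpace ℂ (Fin n) → ℂ),
      (∀ i, ProjKernel.IsProjInvKernel X (K i)) →
      ProjKernel.CompactOpenTendsto X l K L →
      ProjKernel.IsNonDegenerate X L →
      ProjKernel.IsProjInvKernel X L) := by
  refine ⟨fun K L hK hL => hK.mul hL, fun K M hK hM => ?_,
    fun K P s hK hP hPs => hK.power hXo hXc hP hPs,
    fun ι l _ K L hK h hL => .of_compactOpenTendsto hXo hK h hL⟩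
  obtain ⟨hM0, -, ω, hω⟩ := id hM
  have hpos := hK.posSemidef.rescale hω
  have haut := hK.rescaledByAut.of_rescaling hM
  exact ⟨⟨hpos, haut⟩, fun hhol => ⟨hhol, hM0, hpos, haut⟩⟩
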